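/- Let $K\subset\mathbb{C}$ be a convex domain, i.e. a compact convex set with nonempty interior, whose boundary $\partial K$ is a $C^2$-smooth closed curve (a simple closed curve with a regular periodic $C^2$ parametrization $\gamma$). Let $\kappa>0$ and suppose that the curvature $|\dot\gamma\times\ddot\gamma|/|\dot\gamma|^3$ of $\partial K$ is at least $\kappa$ at every point of $\partial K$. Write $\|p\|=\max_{z\in K}|p(z)|$. Then for every integer $n\ge 0$ and every complex polynomial $p$ of degree exactly $n$ all of whose zeros lie in $K$, $$\|p'\|\ \ge\ \frac{\kappa}{2}\,n\,\|p\| .$$ Equivalently, the inverse Markov factor $M_n(K)=\inf_p \|p'\|/\|p\|$, the infimum being over all complex polynomials $p$ of degree exactly $n$ with all zeros in $K$, satisfies $M_n(K)\ge \frac{\kappa}{2}\,n$. -/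

import Mathlib

noncomputable section

/-- A convex domain of the complex plane: a compact convex set with nonempty interior. -/
structure IsConvexDomain (K : Set ℂ) : Prop where
  isCompact : IsCompact K
  convex : Convex ℝ K
  nonempty_interior : (interior K).Nonempty

/-- `γ` is a regular, `T`-periodic `C²` parametrization of `Γ` as a simple closed curve
(being `C²` and periodic on the whole line, it also closes up in a `C²` way). -/
structure IsC2ClosedParam (γ : ℝ → ℂ) (T : ℝ) (Γ : Set ℂ) : Prop where
  period_pos : 0 < T
  periodic : Function.Periodic γ T
  contDiff : ContDiff ℝ 2 γ
  regular : ∀ t, deriv γ t ≠ 0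
  injOn : Set.InjOn γ (Set.Ico 0 T)
  range_eq : Set.range γ = Γ

/-- The curvature `|γ' × γ''| / |γ'|³` of a plane curve at the parameter value `t`. -/
def planeCurvature (γ : ℝ → ℂ) (t : ℝ) : ℝ :=
  |(deriv γ t).re * (deriv (deriv γ) t).im - (deriv γ t).im * (deriv (deriv γ) t).re|
    / ‖deriv γ t‖ ^ 3

/-- The sup norm of a polynomial on `K` (used for nonempty compact `K`). -/
def polySupNorm (K : Set ℂ) (p : Polynomial ℂ) : ℝ :=
  sSup ((fun z => ‖p.eval z‖) '' K)

/-- The polynomials of degree exactly `n` all of whose complex zeros lie in `K`. -/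
def polysWithZerosIn (n : ℕ) (K : Set ℂ) : Set (Polynomial ℂ) :=
  {p | p.degree = n ∧ ∀ z : ℂ, p.IsRoot z → z ∈ K}

/-- The inverse Markov factor `M_n(K)`: the infimum of `‖p'‖ / ‖p‖` over all polynomials `p` of
degree exactly `n` with all zeros in `K`. -/
def inverseMarkovFactor (n : ℕ) (K : Set ℂ) : ℝ :=
  sInf ((fun p => polySupNorm K (Polynomial.derivative p) / polySupNorm K p) ''
    polysWithZerosIn n K)

end

/-!
By Blaschke's rolling theorem, a convex domain `K` whose boundary has curvature at least `κ` lies,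
for each boundary point `z`, in a disc of radius `R = 1 / κ` with `z` on its boundary
(`IsConvexDomain.exists_disc_of_mem_frontier`). If all zeros `w` of `p` lie in `K`, the inversion
`w ↦ 1 / (z - w)` maps them into one half-plane at distance `1 / (2 R) = κ / 2` from the origin, so
the logarithmic derivative `p' / p = ∑ 1 / (z - w)` has modulus at least `n κ / 2` at `z`
(`le_norm_eval_derivative_of_disc`). The maximum principle provides a boundary point `z` at which
`|p|` attains its maximum over `K`, and the bound follows.

The rolling theorem is proved with the tangent angle `θ` of the boundary curve. Each tangent line
supports `K` (`planeCross_mul_nonneg_of_mem_frontier`), so after orienting the curve the signed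
curvature is positive and `θ` increases onto the whole line. The centre `c t` of the disc of radius
`R` touching the curve at `γ t` moves with velocity `|γ'| - R θ' ≤ 0` along the unit tangent. Hence
for parameters `t₀`, `t₁` at which the tangent angles differ by at most `π`, the supporting line of
the disc about `c t₀` that is parallel to the tangent at `t₁` lies beyond that tangent, as seen
from `K` (`planeCross_center_le`). Angles within `π` of `θ t₀` cover all directions, so `K` lies in
every half-plane containing the disc about `c t₀`, that is, in the disc.
-/

/-! ### Cross product and supporting half-planes -/

/-- The scalar cross product `a × b = Im (ā b)` of two plane vectors. -/
def planeCross (a b : ℂ) : ℝ := a.re * b.im - a.im * b.re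

/-- `b ↦ a × b` as a continuous real-linear functional. -/
noncomputable def planeCrossCLM (a : ℂ) : ℂ →L[ℝ] ℝ := a.re • Complex.imCLM - a.im • Complex.reCLM

lemma planeCrossCLM_apply (a b : ℂ) : planeCrossCLM a b = planeCross a b := by
  simp [planeCrossCLM, planeCross]

lemma hasDerivAt_planeCross (a : ℂ) {f : ℝ → ℂ} {f' : ℂ} {t : ℝ} (hf : HasDerivAt f f' t) :
    HasDerivAt (fun s => planeCross a (f s)) (planeCross a f') t := by
  have := (planeCrossCLM a).hasFDerivAt.comp_hasDerivAt t hf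
  simpa only [Function.comp_def, planeCrossCLM_apply] using this

lemma planeCross_neg_left (a b : ℂ) : planeCross (-a) b = -planeCross a b := by
  simp [planeCross]; ring

lemma planeCross_add_right (a b c : ℂ) :
    planeCross a (b + c) = planeCross a b + planeCross a c := by
  simp [planeCross]; ring

lemma planeCross_sub_right (a b c : ℂ) :
    planeCross a (b - c) = planeCross a b - planeCross a c := by
  simp [planeCross]; ring

lemma planeCross_real_mul_left (r : ℝ) (a b : ℂ) :
    planeCross (r * a) b = r * planeCross a b := by
  simp [planeCross]; ring

lemma planeCross_real_mul_right (r : ℝ) (a b : ℂ) :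
    planeCross a (r * b) = r * planeCross a b := by
  simp [planeCross]; ring

lemma continuous_planeCross {X : Type*} [TopologicalSpace X] {f g : X → ℂ} (hf : Continuous f)
    (hg : Continuous g) : Continuous fun x => planeCross (f x) (g x) := by
  unfold planeCross; fun_prop

/-- A real-linear functional on the plane that vanishes at `a ≠ 0` is a multiple of `a × ·`. -/
lemma exists_eq_mul_planeCross {a : ℂ} (ha : a ≠ 0) (f : ℂ →L[ℝ] ℝ) (hf : f a = 0) :
    ∃ c : ℝ, ∀ w, f w = c * planeCross a w := by
  have hlin : ∀ w : ℂ, f w = w.re * f 1 + w.im * f Complex.I := by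
    intro w
    have hw : w = w.re • (1 : ℂ) + w.im • Complex.I := by
      simp [Complex.re_add_im]
    conv_lhs => rw [hw]
    rw [map_add, map_smul, map_smul, smul_eq_mul, smul_eq_mul]
  have h0 := hlin a
  rw [hf] at h0
  have hn : a.re ^ 2 + a.im ^ 2 ≠ 0 := by
    intro h
    apply ha
    apply Complex.ext
    · exact pow_eq_zero_iff two_ne_zero |>.1 (by nlinarith [sq_nonneg a.re, sq_nonneg a.im])
    · exact pow_eq_zero_iff two_ne_zero |>.1 (by nlinarith [sq_nonneg a.re, sq_nonneg a.im])
  refine ⟨(a.re * f Complex.I - a.im * f 1) / (a.re ^ 2 + a.im ^ 2), fun w => ?_⟩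
  rw [hlin w, div_mul_eq_mul_div, eq_div_iff hn]
  unfold planeCross
  linear_combination -(w.re * a.re + w.im * a.im) * h0

/-- At a boundary point of a convex set through which a curve in the set runs with velocity `v`,
the set lies on one side of the tangent line, and its interior points lie strictly on that side. -/
lemma planeCross_mul_nonneg_of_mem_frontier {K : Set ℂ} (hconv : Convex ℝ K)
    {o : ℂ} (ho : o ∈ interior K) {γ : ℝ → ℂ} (hγK : ∀ s, γ s ∈ K) {t : ℝ}
    (ht : γ t ∈ frontier K) {v : ℂ} (hd : HasDerivAt γ v t) (hv : v ≠ 0) :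
    planeCross v (o - γ t) ≠ 0 ∧
      ∀ w ∈ K, 0 ≤ planeCross v (o - γ t) * planeCross v (w - γ t) := by
  obtain ⟨f, hf⟩ := geometric_hahn_banach_open_point (E := ℂ) hconv.interior isOpen_interior
    (x := γ t) ht.2
  have hle : ∀ w ∈ K, f w ≤ f (γ t) := by
    have hsub : closure (interior K) ⊆ {w | f w ≤ f (γ t)} :=
      closure_minimal (fun w hw => (hf w hw).le) (isClosed_le f.continuous continuous_const)
    rw [hconv.closure_interior_eq_closure_of_nonempty_interior ⟨o, ho⟩] at hsub
    exact fun w hw => hsub (subset_closure hw)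
  have hfv : f v = 0 := by
    have hmax : IsLocalMax (fun s => f (γ s)) t :=
      Filter.Eventually.of_forall fun s => hle _ (hγK s)
    exact hmax.hasDerivAt_eq_zero (f.hasFDerivAt.comp_hasDerivAt t hd)
  obtain ⟨c, hc⟩ := exists_eq_mul_planeCross hv f hfv
  have ho' : c * planeCross v (o - γ t) < 0 := by
    rw [← hc, map_sub]; linarith [hf o ho]
  refine ⟨fun h => by simp [h] at ho', fun w hw => ?_⟩
  have hw' : c * planeCross v (w - γ t) ≤ 0 := by
    rw [← hc, map_sub]; linarith [hle w hw]
  by_contra! hneg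
  have hc0 : c ≠ 0 := by rintro rfl; simp at ho'
  nlinarith [mul_nonneg_of_nonpos_of_nonpos ho'.le hw',
    mul_neg_of_pos_of_neg (sq_pos_of_ne_zero hc0) hneg]

/-- A function with a global minimum at `t` has nonnegative second derivative there. -/
lemma deriv_deriv_nonneg_of_forall_le {f : ℝ → ℝ} {t : ℝ} (hc : ContinuousAt f t)
    (hmin : ∀ s, f t ≤ f s) : 0 ≤ deriv (deriv f) t := by
  by_contra! hneg
  have hlmin : IsLocalMin f t := Filter.Eventually.of_forall hmin
  have hlmax := isLocalMax_of_deriv_deriv_neg hneg hlmin.deriv_eq_zero hc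
  have heq : f =ᶠ[nhds t] fun _ => f t := hlmax.mono fun s hs => le_antisymm hs (hmin s)
  have := heq.deriv.deriv_eq
  simp at this
  exact hneg.ne this

/-! ### The tangent angle -/

/-- A nowhere vanishing `C¹` curve `f` in the plane has a differentiable polar angle, with
derivative `(f × f') / |f|²`; the angle is measured from the direction at `t₀`. It is the imaginary
part of a primitive of `f' / f`. -/
lemma exists_angle_lift {f : ℝ → ℂ} (hf : ContDiff ℝ 1 f) (h0 : ∀ t, f t ≠ 0) (t₀ : ℝ) :
    ∃ θ : ℝ → ℝ, θ t₀ = 0 ∧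
      (∀ t, HasDerivAt θ (planeCross (f t) (deriv f t) / ‖f t‖ ^ 2) t) ∧
      ∀ t, f t = ‖f t‖ * (f t₀ / ‖f t₀‖ * Complex.exp (θ t * Complex.I)) := by
  have hcont : Continuous fun t => deriv f t / f t :=
    (hf.continuous_deriv le_rfl).div hf.continuous h0
  let L : ℝ → ℂ := fun t => ∫ s in t₀..t, deriv f s / f s
  have hLd : ∀ t, HasDerivAt L (deriv f t / f t) t := fun t =>
    (hcont.integral_hasStrictDerivAt t₀ t).hasDerivAt
  have hL0 : L t₀ = 0 := intervalIntegral.integral_same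
  have hfd : ∀ t, HasDerivAt f (deriv f t) t := fun t =>
    (hf.differentiable one_ne_zero t).hasDerivAt
  have hprod : ∀ t, HasDerivAt (fun t => f t * Complex.exp (-L t)) 0 t := by
    intro t
    refine ((hfd t).mul (hLd t).fun_neg.cexp).congr_deriv ?_
    linear_combination (-Complex.exp (-L t)) * mul_div_cancel₀ (deriv f t) (h0 t)
  have hconst : ∀ t, f t = f t₀ * Complex.exp (L t) := by
    intro t
    have := is_const_of_deriv_eq_zero (fun t => (hprod t).differentiableAt)
      (fun t => (hprod t).deriv) t t₀
    beta_reduce at this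
    rw [hL0, neg_zero, Complex.exp_zero, mul_one] at this
    rw [← this, mul_assoc, ← Complex.exp_add, neg_add_cancel, Complex.exp_zero, mul_one]
  refine ⟨fun t => (L t).im, congrArg Complex.im hL0, fun t => ?_, fun t => ?_⟩
  · have := Complex.imCLM.hasFDerivAt.comp_hasDerivAt t (hLd t)
    refine this.congr_deriv ?_
    rw [Complex.imCLM_apply, Complex.div_im, ← Complex.normSq_eq_norm_sq, planeCross]
    ring
  · have hn : ‖f t‖ = ‖f t₀‖ * Real.exp (L t).re := by
      rw [hconst t, norm_mul, Complex.norm_exp]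
    have h1 : (‖f t₀‖ : ℂ) ≠ 0 := by simpa using h0 t₀
    rw [hn]
    conv_lhs => rw [hconst t, ← Complex.re_add_im (L t), Complex.exp_add]
    push_cast
    field_simp

/-! ### Blaschke's rolling theorem -/

/-- A differentiable function on the line whose derivative is at least `m > 0` is onto. -/
lemma surjective_of_hasDerivAt_ge {θ θ' : ℝ → ℝ} (hθ : ∀ t, HasDerivAt θ (θ' t) t) {m : ℝ}
    (hm : 0 < m) (hle : ∀ t, m ≤ θ' t) : Function.Surjective θ := by
  have hcont : Continuous θ := continuous_iff_continuousAt.2 fun t => (hθ t).continuousAt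
  have hmono : Monotone fun t => θ t - m * t := by
    have hd : ∀ t, HasDerivAt (fun t => θ t - m * t) (θ' t - m) t := fun t => by
      simpa using (hθ t).fun_sub ((hasDerivAt_id' t).const_mul m)
    refine monotone_of_deriv_nonneg (fun t => (hd t).differentiableAt) fun t => ?_
    rw [(hd t).deriv]
    linarith [hle t]
  intro y
  refine mem_range_of_exists_le_of_exists_ge hcont ⟨min 0 ((y - θ 0) / m), ?_⟩
    ⟨max 0 ((y - θ 0) / m), ?_⟩
  · have h1 := hmono (min_le_left 0 ((y - θ 0) / m))
    have h2 : m * min 0 ((y - θ 0) / m) ≤ m * ((y - θ 0) / m) :=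
      mul_le_mul_of_nonneg_left (min_le_right _ _) hm.le
    rw [mul_div_cancel₀ _ hm.ne'] at h2
    simp only [mul_zero, sub_zero] at h1
    linarith
  · have h1 := hmono (le_max_left 0 ((y - θ 0) / m))
    have h2 : m * ((y - θ 0) / m) ≤ m * max 0 ((y - θ 0) / m) :=
      mul_le_mul_of_nonneg_left (le_max_right _ _) hm.le
    rw [mul_div_cancel₀ _ hm.ne'] at h2
    simp only [mul_zero, sub_zero] at h1
    linarith

/-- A continuous periodic positive function is bounded below by a positive constant. -/
lemma exists_pos_le_of_periodic {g : ℝ → ℝ} {T : ℝ} (hT : 0 < T) (hg : Function.Periodic g T)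
    (hc : Continuous g) (hpos : ∀ t, 0 < g t) : ∃ m, 0 < m ∧ ∀ t, m ≤ g t := by
  obtain ⟨x, -, hx⟩ := isCompact_Icc.exists_isMinOn (Set.nonempty_Icc.2 hT.le) hc.continuousOn
  refine ⟨g x, hpos x, fun t => ?_⟩
  obtain ⟨y, hy, hty⟩ := hg.exists_mem_Ico₀ hT t
  rw [hty]
  exact hx (Set.Ico_subset_Icc_self hy)

lemma planeCross_exp (e : ℂ) (he : ‖e‖ = 1) (a b : ℝ) :
    planeCross (e * Complex.exp (a * Complex.I)) (e * Complex.exp (b * Complex.I)) =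
      Real.sin (b - a) := by
  have h : e.re ^ 2 + e.im ^ 2 = 1 := by
    have := Complex.sq_norm e
    rw [he, Complex.normSq_apply] at this
    linarith
  simp only [planeCross, Complex.mul_re, Complex.mul_im, Complex.exp_ofReal_mul_I_re,
    Complex.exp_ofReal_mul_I_im, Real.sin_sub]
  linear_combination (Real.cos a * Real.sin b - Real.sin a * Real.cos b) * h

/-- A point whose displacement from `c` has cross product at least `-R` with every unit vector
lies in the closed disc of radius `R` about `c`. -/
lemma norm_le_of_forall_planeCross {z : ℂ} {R : ℝ} (hR : 0 ≤ R)
    (h : ∀ u : ℂ, ‖u‖ = 1 → -R ≤ planeCross u z) : ‖z‖ ≤ R := by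
  rcases eq_or_ne z 0 with rfl | hz
  · simpa using hR
  have hz' : 0 < ‖z‖ := norm_pos_iff.2 hz
  have h1 := h ((‖z‖⁻¹ : ℝ) * (Complex.I * z)) (by
    simp [hz'.ne'])
  have h2 : planeCross (Complex.I * z) z = -‖z‖ ^ 2 := by
    rw [Complex.sq_norm, Complex.normSq_apply]
    simp [planeCross]
    ring
  rw [planeCross_real_mul_left, h2] at h1
  have : ‖z‖⁻¹ * -‖z‖ ^ 2 = -‖z‖ := by field_simp
  linarith

/-- Let the disc of radius `R` touching the curve `γ` from the left be centred at `c = γ + R i u`,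
where `u = e exp (i θ)` is the unit tangent. If the curvature is at least `1 / R`, that is
`|γ'| ≤ R θ'`, then `c' = (|γ'| - R θ') u` points backwards, so as long as the tangent turns by at
most `π` between `t₀` and `t₁` the centre `c t₁` lies on the left of the tangent direction at `t₁`,
seen from `c t₀`. -/
lemma planeCross_center_le {γ : ℝ → ℂ} {v θ θ' : ℝ → ℝ} {e : ℂ} {R : ℝ} (he : ‖e‖ = 1)
    (hγ : ∀ t, HasDerivAt γ (v t * (e * Complex.exp (θ t * Complex.I))) t)
    (hθ : ∀ t, HasDerivAt θ (θ' t) t) (hθ0 : ∀ t, 0 ≤ θ' t) (hR : ∀ t, v t ≤ R * θ' t)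
    {t₀ t₁ : ℝ} (hturn : |θ t₁ - θ t₀| ≤ Real.pi) :
    planeCross (e * Complex.exp (θ t₁ * Complex.I))
        (γ t₀ + R * (Complex.I * (e * Complex.exp (θ t₀ * Complex.I)))) ≤
      planeCross (e * Complex.exp (θ t₁ * Complex.I))
        (γ t₁ + R * (Complex.I * (e * Complex.exp (θ t₁ * Complex.I)))) := by
  have hmono : Monotone θ :=
    monotone_of_deriv_nonneg (fun t => (hθ t).differentiableAt) fun t => by
      rw [(hθ t).deriv]; exact hθ0 t
  set φ : ℝ → ℝ := fun t => planeCross (e * Complex.exp (θ t₁ * Complex.I))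
    (γ t + R * (Complex.I * (e * Complex.exp (θ t * Complex.I)))) with hφ
  have hφd : ∀ t, HasDerivAt φ ((v t - R * θ' t) * Real.sin (θ t - θ t₁)) t := by
    intro t
    have h1 : HasDerivAt (fun t => Complex.exp (θ t * Complex.I))
        (Complex.exp (θ t * Complex.I) * (θ' t * Complex.I)) t :=
      ((hθ t).ofReal_comp.mul_const Complex.I).cexp
    have h2 := (hγ t).fun_add (((h1.const_mul e).const_mul Complex.I).const_mul (R : ℂ))
    refine (hasDerivAt_planeCross _ h2).congr_deriv ?_
    rw [← planeCross_exp e he, ← planeCross_real_mul_right]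
    congr 1
    push_cast
    linear_combination (R * e * Complex.exp (θ t * Complex.I) * θ' t) * Complex.I_mul_I
  have hφc : Continuous φ := continuous_iff_continuousAt.2 fun t => (hφd t).continuousAt
  rcases le_total t₀ t₁ with h | h
  · have hm : MonotoneOn φ (Set.Icc t₀ t₁) := by
      refine monotoneOn_of_deriv_nonneg (convex_Icc _ _) hφc.continuousOn
        (fun t _ => (hφd t).differentiableAt.differentiableWithinAt) fun t ht => ?_
      rw [interior_Icc] at ht
      rw [(hφd t).deriv]
      have h1 := hmono ht.1.le
      have h2 := hmono ht.2.le
      refine mul_nonneg_of_nonpos_of_nonpos (by linarith [hR t])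
        (Real.sin_nonpos_of_nonpos_of_neg_pi_le (by linarith) ?_)
      linarith [(abs_le.1 hturn).2]
    exact hm (Set.left_mem_Icc.2 h) (Set.right_mem_Icc.2 h) h
  · have hm : AntitoneOn φ (Set.Icc t₁ t₀) := by
      refine antitoneOn_of_deriv_nonpos (convex_Icc _ _) hφc.continuousOn
        (fun t _ => (hφd t).differentiableAt.differentiableWithinAt) fun t ht => ?_
      rw [interior_Icc] at ht
      rw [(hφd t).deriv]
      have h1 := hmono ht.1.le
      have h2 := hmono ht.2.le
      refine mul_nonpos_of_nonpos_of_nonneg (by linarith [hR t])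
        (Real.sin_nonneg_of_nonneg_of_le_pi (by linarith) ?_)
      linarith [(abs_le.1 hturn).1]
    exact hm (Set.left_mem_Icc.2 h) (Set.right_mem_Icc.2 h) h

/-- Blaschke's rolling theorem for a curve that keeps the set on its left. No injectivity of the
curve is needed: it suffices that its tangent angle takes every value. -/
lemma exists_disc_of_left {K : Set ℂ} {γ : ℝ → ℂ} {T : ℝ} (hT : 0 < T)
    (hper : Function.Periodic γ T) (hC : ContDiff ℝ 2 γ) (hreg : ∀ t, deriv γ t ≠ 0)
    (hγK : ∀ t, γ t ∈ K) (hleft : ∀ t, ∀ w ∈ K, 0 ≤ planeCross (deriv γ t) (w - γ t))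
    {κ : ℝ} (hκ : 0 < κ) (hcurv : ∀ t, κ ≤ planeCurvature γ t) (t₀ : ℝ) :
    ∃ u : ℂ, ‖u‖ = 1 ∧ ∀ w ∈ K, ‖w - (γ t₀ + κ⁻¹ * u)‖ ≤ κ⁻¹ := by
  have hC1 : ContDiff ℝ 1 (deriv γ) := ContDiff.deriv' (n := 1) (by rwa [one_add_one_eq_two])
  have hγd : ∀ t, HasDerivAt γ (deriv γ t) t := fun t =>
    (hC.differentiable two_ne_zero t).hasDerivAt
  have hγd2 : ∀ t, HasDerivAt (deriv γ) (deriv (deriv γ) t) t := fun t =>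
    (hC1.differentiable one_ne_zero t).hasDerivAt
  -- Convexity makes the signed curvature nonnegative, so the absolute value can be dropped.
  have hsign : ∀ t, 0 ≤ planeCross (deriv γ t) (deriv (deriv γ) t) := by
    intro t
    have hd : ∀ s, HasDerivAt (fun s => planeCross (deriv γ t) (γ s - γ t))
        (planeCross (deriv γ t) (deriv γ s)) s := fun s =>
      hasDerivAt_planeCross _ ((hγd s).sub_const _)
    have := deriv_deriv_nonneg_of_forall_le (t := t) (hd t).continuousAt fun s => by
      simpa [planeCross] using hleft t _ (hγK s)
    rwa [funext fun s => (hd s).deriv, (hasDerivAt_planeCross _ (hγd2 t)).deriv] at this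
  have hv : ∀ t, 0 < ‖deriv γ t‖ := fun t => norm_pos_iff.2 (hreg t)
  have hθge : ∀ t, κ * ‖deriv γ t‖ ≤
      planeCross (deriv γ t) (deriv (deriv γ) t) / ‖deriv γ t‖ ^ 2 := by
    intro t
    have h := hcurv t
    rw [planeCurvature, le_div_iff₀ (pow_pos (hv t) 3)] at h
    change _ ≤ |planeCross (deriv γ t) (deriv (deriv γ) t)| at h
    rw [abs_of_nonneg (hsign t)] at h
    rw [le_div_iff₀ (pow_pos (hv t) 2)]
    linarith
  have hperd : Function.Periodic (deriv γ) T := fun t => by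
    rw [← deriv_comp_add_const, funext hper]
  obtain ⟨m, hm, hmle⟩ := exists_pos_le_of_periodic hT (hperd.comp norm)
    (hC1.continuous.norm) hv
  obtain ⟨θ, hθ0, hθd, hθ⟩ := exists_angle_lift hC1 hreg t₀
  have hθsurj := surjective_of_hasDerivAt_ge hθd (mul_pos hκ hm) fun t =>
    (mul_le_mul_of_nonneg_left (hmle t) hκ.le).trans (hθge t)
  set e : ℂ := deriv γ t₀ / ‖deriv γ t₀‖ with he
  have he1 : ‖e‖ = 1 := by simp [he, hreg t₀]
  refine ⟨Complex.I * e, by simp [he1], fun w hw =>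
    norm_le_of_forall_planeCross (inv_nonneg.2 hκ.le) fun a ha => ?_⟩
  -- A point of the curve whose tangent direction is `a`, at most half a turn away from `t₀`.
  obtain ⟨t₁, ht₁⟩ := hθsurj (Complex.arg (a / e))
  have ha1 : a = e * Complex.exp (θ t₁ * Complex.I) := by
    have he0 : e ≠ 0 := norm_ne_zero_iff.1 (by simp [he1])
    have := Complex.norm_mul_exp_arg_mul_I (a / e)
    rw [norm_div, ha, he1, div_one, Complex.ofReal_one, one_mul, ← ht₁] at this
    rw [this, mul_div_cancel₀ _ he0]
  have hroll := planeCross_center_le (R := κ⁻¹) he1 (fun t => hθ t ▸ hγd t) hθd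
    (fun t => (mul_nonneg hκ.le (hv t).le).trans (hθge t))
    (fun t => by rw [inv_mul_eq_div, le_div_iff₀ hκ]; linarith [hθge t]) (t₀ := t₀) (t₁ := t₁)
    (by rw [hθ0, ht₁, sub_zero]; exact Complex.abs_arg_le_pi _)
  rw [← ha1, hθ0, Complex.ofReal_zero, zero_mul, Complex.exp_zero, mul_one] at hroll
  have hw1 := hleft t₁ w hw
  rw [hθ t₁, planeCross_real_mul_left] at hw1
  rw [← ha1] at hw1
  have hw2 := nonneg_of_mul_nonneg_right hw1 (hv t₁)
  have hIa : planeCross a (Complex.I * a) = 1 := by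
    have := Complex.sq_norm a
    rw [ha, Complex.normSq_apply] at this
    simp [planeCross]
    linarith
  have hlast : planeCross a (γ t₁ + (κ⁻¹ : ℝ) * (Complex.I * a)) = planeCross a (γ t₁) + κ⁻¹ := by
    rw [planeCross_add_right, planeCross_real_mul_right, hIa, mul_one]
  rw [hlast] at hroll
  rw [planeCross_sub_right] at hw2 ⊢
  linarith

/-- Blaschke's rolling theorem: a convex domain bounded by a `C²` curve of curvature at least `κ`
lies, for every boundary point, in a disc of radius `1 / κ` having that point on its boundary. -/
lemma IsConvexDomain.exists_disc_of_mem_frontier {K : Set ℂ} (hK : IsConvexDomain K)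
    {γ : ℝ → ℂ} {T : ℝ} (hγ : IsC2ClosedParam γ T (frontier K))
    {κ : ℝ} (hκ : 0 < κ) (hcurv : ∀ t : ℝ, κ ≤ planeCurvature γ t) {z : ℂ}
    (hz : z ∈ frontier K) :
    ∃ u : ℂ, ‖u‖ = 1 ∧ ∀ w ∈ K, ‖w - (z + κ⁻¹ * u)‖ ≤ κ⁻¹ := by
  obtain ⟨o, ho⟩ := hK.nonempty_interior
  have hfr : ∀ t, γ t ∈ frontier K := fun t => hγ.range_eq ▸ Set.mem_range_self t
  have hγK : ∀ t, γ t ∈ K := fun t => hK.isCompact.isClosed.frontier_subset (hfr t)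
  have hd : ∀ t, HasDerivAt γ (deriv γ t) t := fun t =>
    (hγ.contDiff.differentiable two_ne_zero t).hasDerivAt
  have hside := fun t => planeCross_mul_nonneg_of_mem_frontier hK.convex ho hγK (hfr t) (hd t)
    (hγ.regular t)
  set g : ℝ → ℝ := fun t => planeCross (deriv γ t) (o - γ t) with hg
  have hgc : Continuous g := continuous_planeCross (hγ.contDiff.continuous_deriv one_le_two)
    (continuous_const.sub hγ.contDiff.continuous)
  obtain ⟨t₀, rfl⟩ : z ∈ Set.range γ := hγ.range_eq ▸ hz
  -- The interior point `o` stays on the same side of the tangent line along the whole curve.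
  by_cases hpos : ∀ t, 0 < g t
  · exact exists_disc_of_left hγ.period_pos hγ.periodic hγ.contDiff hγ.regular hγK
      (fun t w hw => nonneg_of_mul_nonneg_right ((hside t).2 w hw) (hpos t)) hκ hcurv t₀
  · have hneg : ∀ t, g t < 0 := by
      push Not at hpos
      obtain ⟨a, ha⟩ := hpos
      intro b
      by_contra! hb
      obtain ⟨c, hc⟩ := mem_range_of_exists_le_of_exists_ge hgc ⟨a, ha⟩ ⟨b, hb⟩
      exact (hside c).1 hc
    -- A curve with the set on its right is traversed backwards.
    have hd1 : deriv (fun t => γ (-t)) = fun t => -deriv γ (-t) :=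
      funext fun t => deriv_comp_neg γ t
    have hd2 : deriv (fun t => -deriv γ (-t)) = fun t => deriv (deriv γ) (-t) := by
      funext t
      rw [deriv.fun_neg, deriv_comp_neg, neg_neg]
    obtain ⟨u, hu, h⟩ := exists_disc_of_left (γ := fun t => γ (-t)) (K := K) hγ.period_pos
      (fun t => by
        have := hγ.periodic (-(t + T))
        rwa [neg_add, neg_add_cancel_right, eq_comm, ← neg_add] at this) (hγ.contDiff.comp contDiff_neg)
      (fun t => by rw [hd1]; exact neg_ne_zero.2 (hγ.regular _)) (fun t => hγK _)
      (fun t w hw => by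
        rw [hd1, planeCross_neg_left]
        have := (hside (-t)).2 w hw
        have hn : g (-t) < 0 := hneg (-t)
        by_contra! hlt
        have : g (-t) * planeCross (deriv γ (-t)) (w - γ (-t)) < 0 :=
          mul_neg_of_neg_of_pos hn (by linarith)
        linarith)
      hκ (fun t => by
        have := hcurv (-t)
        unfold planeCurvature at this ⊢
        rw [hd1, hd2]
        simp only [Complex.neg_re, Complex.neg_im, norm_neg, neg_mul, sub_neg_eq_add]
        rwa [neg_add_eq_sub, abs_sub_comm]) (-t₀)
    exact ⟨u, hu, by simpa using h⟩

/-! ### Logarithmic derivatives and the sup norm -/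

/-- The inversion `d ↦ 1 / d` maps a disc of radius `R` with `0` on its boundary, punctured at `0`,
into a half-plane at distance `1 / (2 R)` from `0`. -/
lemma le_re_mul_one_div_of_norm_sub_le {d u : ℂ} {κ : ℝ} (hκ : 0 < κ) (hu : ‖u‖ = 1)
    (hd : d ≠ 0) (h : ‖d - κ⁻¹ * u‖ ≤ κ⁻¹) : κ / 2 ≤ (u * (1 / d)).re := by
  have hN : 0 < Complex.normSq d := Complex.normSq_pos.2 hd
  have h1 : u.re * u.re + u.im * u.im = 1 := by
    rw [← Complex.normSq_apply, ← Complex.sq_norm, hu, one_pow]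
  have h2 : ‖κ * d - u‖ ^ 2 ≤ 1 := by
    have he : (κ : ℂ) * d - u = κ * (d - κ⁻¹ * u) := by
      have : (κ : ℂ) ≠ 0 := by exact_mod_cast hκ.ne'
      push_cast
      field_simp
    have hle : ‖(κ : ℂ) * d - u‖ ≤ 1 := by
      rw [he, norm_mul, Complex.norm_real, Real.norm_of_nonneg hκ.le]
      calc κ * _ ≤ κ * κ⁻¹ := mul_le_mul_of_nonneg_left h hκ.le
        _ = 1 := mul_inv_cancel₀ hκ.ne'
    exact pow_le_one₀ (norm_nonneg _) hle
  rw [Complex.sq_norm, Complex.normSq_apply] at h2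
  simp only [Complex.sub_re, Complex.sub_im, Complex.re_ofReal_mul, Complex.im_ofReal_mul] at h2
  have h3 : κ * Complex.normSq d ≤ 2 * (u.re * d.re + u.im * d.im) := by
    rw [Complex.normSq_apply]
    refine le_of_mul_le_mul_left ?_ hκ
    nlinarith
  have h4 : (u * (1 / d)).re = (u.re * d.re + u.im * d.im) / Complex.normSq d := by
    rw [mul_one_div, Complex.div_re]
    ring
  rw [h4, le_div_iff₀ hN]
  linarith

/-- If all zeros of `p` lie in a disc of radius `1 / κ` with `z` on its boundary, then
`|p' z| ≥ κ / 2 * deg p * |p z|`. -/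
lemma le_norm_eval_derivative_of_disc {p : Polynomial ℂ} {z u : ℂ} {κ : ℝ} (hκ : 0 < κ)
    (hu : ‖u‖ = 1) (hz : p.eval z ≠ 0)
    (hroots : ∀ w ∈ p.roots, ‖w - (z + κ⁻¹ * u)‖ ≤ κ⁻¹) :
    κ / 2 * p.natDegree * ‖p.eval z‖ ≤ ‖p.derivative.eval z‖ := by
  have hp := IsAlgClosed.splits p
  have hsum : κ / 2 * p.natDegree ≤ ((-u) * (p.roots.map fun w => 1 / (z - w)).sum).re := by
    rw [← Multiset.sum_map_mul_left, ← Complex.coe_reAddGroupHom, map_multiset_sum,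
      Multiset.map_map, ← hp.natDegree_eq_card_roots.symm]
    have := Multiset.card_nsmul_le_sum
      (s := p.roots.map (Complex.reAddGroupHom ∘ fun w => (-u) * (1 / (z - w)))) (a := κ / 2) (by
      intro x hx
      obtain ⟨w, hw, rfl⟩ := Multiset.mem_map.1 hx
      refine le_re_mul_one_div_of_norm_sub_le hκ (by rwa [norm_neg]) ?_ ?_
      · rw [sub_ne_zero]
        rintro rfl
        exact hz (Polynomial.isRoot_of_mem_roots hw)
      · have he : z - w - (κ⁻¹ : ℝ) * -u = -(w - (z + (κ⁻¹ : ℝ) * u)) := by ring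
        rw [he, norm_neg]
        exact hroots w hw)
    rw [Multiset.card_map, nsmul_eq_mul] at this
    linarith
  rw [← hp.eval_derivative_div_eval_of_ne_zero hz] at hsum
  have := hsum.trans (Complex.re_le_norm _)
  rw [norm_mul, norm_neg, hu, one_mul, norm_div] at this
  rwa [le_div_iff₀ (norm_pos_iff.2 hz)] at this

lemma norm_eval_le_polySupNorm {K : Set ℂ} (hK : IsCompact K) (p : Polynomial ℂ) {z : ℂ}
    (hz : z ∈ K) : ‖p.eval z‖ ≤ polySupNorm K p :=
  le_csSup (hK.image p.continuous.norm).bddAbove (Set.mem_image_of_mem _ hz)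

/-- By the maximum principle, the sup norm of a polynomial on a convex domain is attained at a
boundary point. -/
lemma IsConvexDomain.exists_mem_frontier_polySupNorm_eq {K : Set ℂ} (hK : IsConvexDomain K)
    (p : Polynomial ℂ) : ∃ z ∈ frontier K, polySupNorm K p = ‖p.eval z‖ := by
  have hcl : closure (interior K) = K := by
    rw [hK.convex.closure_interior_eq_closure_of_nonempty_interior hK.nonempty_interior,
      hK.isCompact.isClosed.closure_eq]
  obtain ⟨z, hz, hmax⟩ := Complex.exists_mem_frontier_isMaxOn_norm (f := fun z => p.eval z)
    (hK.isCompact.isBounded.subset interior_subset) hK.nonempty_interior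
    p.differentiable.diffContOnCl
  rw [hcl] at hmax
  have hz' : z ∈ frontier K := frontier_interior_subset hz
  have hzK : z ∈ K := hK.isCompact.isClosed.frontier_subset hz'
  refine ⟨z, hz', le_antisymm (csSup_le ⟨_, Set.mem_image_of_mem _ hzK⟩ ?_)
    (norm_eval_le_polySupNorm hK.isCompact p hzK)⟩
  rintro _ ⟨w, hw, rfl⟩
  exact hmax hw

lemma IsConvexDomain.polySupNorm_pos {K : Set ℂ} (hK : IsConvexDomain K) {p : Polynomial ℂ}
    (hp : p ≠ 0) : 0 < polySupNorm K p := by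
  obtain ⟨o, ho⟩ := hK.nonempty_interior
  have hinf : K.Infinite := infinite_of_mem_nhds o (mem_interior_iff_mem_nhds.1 ho)
  obtain ⟨z, hz, hpz⟩ := (hinf.sdiff p.roots.toFinset.finite_toSet).nonempty
  refine (norm_pos_iff.2 fun h => hpz ?_).trans_le (norm_eval_le_polySupNorm hK.isCompact p hz)
  simpa [hp] using h

/-! ### The inverse Markov inequality -/

theorem mainTheorem1 (K : Set ℂ) (hK : IsConvexDomain K)
    (γ : ℝ → ℂ) (T : ℝ) (hγ : IsC2ClosedParam γ T (frontier K))
    (κ : ℝ) (hκ : 0 < κ) (hcurv : ∀ t : ℝ, κ ≤ planeCurvature γ t) (n : ℕ) :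
    (∀ p ∈ polysWithZerosIn n K,
      κ / 2 * n * polySupNorm K p ≤ polySupNorm K (Polynomial.derivative p)) ∧
    κ / 2 * n ≤ inverseMarkovFactor n K := by
  have hne : ∀ p ∈ polysWithZerosIn n K, p ≠ 0 := by
    rintro p ⟨hdeg, -⟩ rfl
    simp at hdeg
  have hmain : ∀ p ∈ polysWithZerosIn n K,
      κ / 2 * n * polySupNorm K p ≤ polySupNorm K (Polynomial.derivative p) := by
    intro p hp
    obtain ⟨z, hz, hpz⟩ := hK.exists_mem_frontier_polySupNorm_eq p
    obtain ⟨u, hu, hdisc⟩ := hK.exists_disc_of_mem_frontier hγ hκ hcurv hz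
    have hpos := hK.polySupNorm_pos (hne p hp)
    rw [hpz] at hpos ⊢
    rw [← Polynomial.natDegree_eq_of_degree_eq_some hp.1]
    exact (le_norm_eval_derivative_of_disc hκ hu (norm_pos_iff.1 hpos) fun w hw =>
      hdisc w (hp.2 w (Polynomial.isRoot_of_mem_roots hw))).trans
      (norm_eval_le_polySupNorm hK.isCompact _ (hK.isCompact.isClosed.frontier_subset hz))
  refine ⟨hmain, le_csInf ?_ ?_⟩
  · obtain ⟨o, ho⟩ := hK.nonempty_interior
    refine Set.Nonempty.image _ ⟨(Polynomial.X - Polynomial.C o) ^ n, ?_, fun z hz => ?_⟩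
    · rw [Polynomial.degree_pow, Polynomial.degree_X_sub_C, nsmul_one]
    · have : (z - o) ^ n = 0 := by simpa [Polynomial.IsRoot] using hz
      rw [sub_eq_zero.1 (eq_zero_of_pow_eq_zero this)]
      exact interior_subset ho
  · rintro _ ⟨p, hp, rfl⟩
    exact (le_div_iff₀ (hK.polySupNorm_pos (hne p hp))).2 (hmain p hp)
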